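/- **Theorem.** Let $N\ge 1$ and let $X$ be the space of real-valued functions $u\in W^{1,2}(\mathbb{R}^N)$ with $\int_{\mathbb{R}^N}|x|^2|u|^2\,dx<\infty$. Gradients are weak gradients. For every $u\in X$, the function $ue^{|x|^2/2}$ is weakly differentiable, $u-ce^{-|x|^2/2}\in X$ for every $c\in\mathbb{R}$, all integrals below are finite, and $$ \int_{\mathbb{R}^N}|\nabla u|^2\,dx+\int_{\mathbb{R}^N}|x|^2|u|^2\,dx-N\int_{\mathbb{R}^N}|u|^2\,dx =\int_{\mathbb{R}^N}\bigl|\nabla\bigl(ue^{|x|^2/2}\bigr)\bigr|^2e^{-|x|^2}\,dx $$ $$ \ge\frac{2}{N+3}\,\inf_{c\in\mathbb{R}}\left(\int_{\mathbb{R}^N}|\nabla w_c|^2\,dx+\int_{\mathbb{R}^N}|x|^2|w_c|^2\,dx+\int_{\mathbb{R}^N}|w_c|^2\,dx\right),\qquad w_c:=u-ce^{-|x|^2/2}. $$ The inequality is sharp: $\frac{2}{N+3}$ is the largest constant for which it holds for all $u\in X$. Equality is attained nontrivially: the function $u(x)=x_1e^{-|x|^2/2}$ belongs to $X$, and for it both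 sides of the inequality are equal and strictly positive. -/

import Mathlib

open MeasureTheory
open scoped ContDiff

noncomputable section

namespace Heisenberg

variable {N : ℕ}

/-- `G` is a weak (distributional) gradient of `u` on `ℝ^N`: both are locally integrable, and
`∫ u ∂ᵢφ = - ∫ φ Gᵢ` for every test function `φ ∈ C_c^∞(ℝ^N)` and every coordinate `i`. -/
def HasWeakGradient (u : EuclideanSpace ℝ (Fin N) → ℝ)
    (G : EuclideanSpace ℝ (Fin N) → EuclideanSpace ℝ (Fin N)) : Prop :=
  LocallyIntegrable u ∧ LocallyIntegrable G ∧
    ∀ φ : EuclideanSpace ℝ (Fin N) → ℝ, ContDiff ℝ ∞ φ → HasCompactSupport φ →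
      ∀ i : Fin N, ∫ x, u x * fderiv ℝ φ x (EuclideanSpace.single i 1) = - ∫ x, φ x * G x i

/-- `u` has a weak gradient, i.e. `u ∈ W^{1,1}_loc(ℝ^N)`. -/
def WeaklyDifferentiable (u : EuclideanSpace ℝ (Fin N) → ℝ) : Prop :=
  ∃ G, HasWeakGradient u G

open Classical in
/-- The weak gradient `∇u` (unique up to null sets; `0` when `u` is not weakly differentiable). -/
def weakGradient (u : EuclideanSpace ℝ (Fin N) → ℝ) :
    EuclideanSpace ℝ (Fin N) → EuclideanSpace ℝ (Fin N) :=
  if h : WeaklyDifferentiable u then h.choose else 0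

/-- The Sobolev space `W^{1,2}(ℝ^N)` of real-valued functions. -/
def MemW12 (u : EuclideanSpace ℝ (Fin N) → ℝ) : Prop :=
  MemLp u 2 ∧ ∃ G, MemLp G 2 ∧ HasWeakGradient u G

/-- The space `X = {u ∈ W^{1,2}(ℝ^N) : ‖x u‖₂ < ∞}`. -/
def X (N : ℕ) : Set (EuclideanSpace ℝ (Fin N) → ℝ) :=
  {u | MemW12 u ∧ MemLp (fun x => u x • x) 2}

/-- The Gaussian `e^{-|x|²/2}`. -/
def gaussian (x : EuclideanSpace ℝ (Fin N)) : ℝ := Real.exp (-‖x‖ ^ 2 / 2)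

/-- The scale non-invariant Heisenberg deficit `∫ |∇u|² + ∫ |x|²|u|² - N ∫ |u|²`. -/
def deficit (u : EuclideanSpace ℝ (Fin N) → ℝ) : ℝ :=
  (∫ x, ‖weakGradient u x‖ ^ 2) + (∫ x, ‖x‖ ^ 2 * |u x| ^ 2) - N * ∫ x, |u x| ^ 2

/-- The squared full norm `∫ |∇w|² + ∫ |x|²|w|² + ∫ |w|²`. -/
def fullNormSq (w : EuclideanSpace ℝ (Fin N) → ℝ) : ℝ :=
  (∫ x, ‖weakGradient w x‖ ^ 2) + (∫ x, ‖x‖ ^ 2 * |w x| ^ 2) + ∫ x, |w x| ^ 2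

/-- The infimum over `c ∈ ℝ` of the squared full norm of `u - c e^{-|x|²/2}`. -/
def gaussianDistSq (u : EuclideanSpace ℝ (Fin N) → ℝ) : ℝ :=
  ⨅ c : ℝ, fullNormSq (fun x => u x - c * gaussian x)

end Heisenberg

end

/-! Expand `u` in the orthonormal Hermite functions `h_α`, with coefficients `û(α)`. Multiplication
by `x_i` and `∂_i` send `h_α` to combinations of its neighbours `h_{α±e_i}`, so `x_i + ∂_i` is an
annihilation operator and `x_i - ∂_i` a creation operator. By Parseval, `∫ (x_i u + ∂_i u)² = ∑ 2
α_i û(α)²` and `∫ (x_i u - ∂_i u)² = ∑ 2 (α_i + 1) û(α)²` (`HasWeakGradient.hasSum_annihilation`,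
`HasWeakGradient.hasSum_creation`). The difference of the two, `2 ∫ u²`, together with the
parallelogram law completes the square: the deficit is `∫ |∇u + x u|²`, which is also the weighted
Dirichlet integral of `u e^{|x|²/2}`.

Hence the deficit equals `∑ 2 |α| û(α)²`. It does not see the Gaussian mode `α = 0`, and it is at
least twice the squared `L²` norm of the remaining modes
(`HasWeakGradient.two_mul_le_integral_norm_add_sq`). If `w` is `u` minus its Gaussian component, its
squared full norm is the deficit plus `(N + 1) ∫ w²`, so at most `(1 + (N + 1) / 2)` times the
deficit, which is the constant `(N + 3) / 2`. Modes with `|α| = 1`, such as `x_1 e^{-|x|²/2}`, give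
equality.

Two analytic facts support this: completeness of the Hermite functions
(`ae_eq_zero_of_forall_integral_mul_hermiteProd_eq_zero`), and the admissibility of Hermite
functions as test functions for weak gradients in `L²` (`HasWeakGradient.integral_mul_fderiv`). -/

namespace HermiteFunction

/-! ### Hermite polynomials and Hermite functions in one variable. -/

open Polynomial

/-- The normalised (physicists') Hermite polynomials, orthonormal for `e^{-t²} dt`. -/
noncomputable def hermitePoly : ℕ → ℝ[X]
  | 0 => C (√√Real.pi)⁻¹
  | n + 1 => C (√(2 * ((n : ℝ) + 1)))⁻¹ *
      (2 * X * hermitePoly n - derivative (hermitePoly n))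

/-- The normalised Hermite functions. -/
noncomputable def hermiteFun (n : ℕ) (t : ℝ) : ℝ :=
  (hermitePoly n).eval t * Real.exp (-t ^ 2 / 2)

lemma hermitePoly_raise (n : ℕ) :
    2 * X * hermitePoly n - derivative (hermitePoly n)
      = C √(2 * ((n : ℝ) + 1)) * hermitePoly (n + 1) := by
  have h : √(2 * ((n : ℝ) + 1)) ≠ 0 := by positivity
  rw [hermitePoly, ← mul_assoc, ← C_mul, mul_inv_cancel₀ h, C_1, one_mul]

/-- Induction through the commutation of `d/dX` with the raising operator: `(2Xp - p')' = 2p + (2Xp'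
- p'')`, where the last bracket is `2n p` by the induction hypothesis. At `n = 0` the truncated
index `n - 1` is harmless because its coefficient is `√0`; the same convention recurs in the later
recurrences. -/
lemma derivative_hermitePoly (n : ℕ) :
    derivative (hermitePoly n) = C √(2 * (n : ℝ)) * hermitePoly (n - 1) := by
  induction n with
  | zero => simp [hermitePoly]
  | succ n ih =>
    have key : derivative (2 * X * hermitePoly n - derivative (hermitePoly n))
        = C (2 * ((n : ℝ) + 1)) * hermitePoly n := by
      have h2 : 2 * X * derivative (hermitePoly n) - derivative (derivative (hermitePoly n))
          = C (2 * (n : ℝ)) * hermitePoly n := by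
        cases n with
        | zero => simp [hermitePoly]
        | succ m =>
          simp only [Nat.add_sub_cancel] at ih
          rw [ih, derivative_C_mul, mul_left_comm, ← mul_sub, hermitePoly_raise, ← mul_assoc,
            ← C_mul]
          push_cast
          rw [Real.mul_self_sqrt (by positivity)]
      have h3 : (C (2 * ((n : ℝ) + 1)) : ℝ[X]) = C (2 * (n : ℝ)) + 2 := by
        rw [mul_add, C_add, mul_one]; rfl
      rw [h3, add_mul, ← h2]
      simp only [derivative_sub, derivative_mul, derivative_X, derivative_ofNat]
      ring
    rw [hermitePoly, derivative_C_mul, key, ← mul_assoc, ← C_mul]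
    simp only [Nat.add_sub_cancel]
    congr 2
    push_cast
    have h : √(2 * ((n : ℝ) + 1)) ≠ 0 := by positivity
    rw [inv_mul_eq_iff_eq_mul₀ h, Real.mul_self_sqrt (by positivity)]

lemma integrable_eval_mul_exp_neg_sq (p : ℝ[X]) :
    Integrable fun t : ℝ => p.eval t * Real.exp (-t ^ 2) := by
  induction p using Polynomial.induction_on' with
  | add p q hp hq => simpa only [eval_add, add_mul] using! hp.add hq
  | monomial n a =>
    have h := (integrable_rpow_mul_exp_neg_mul_sq one_pos (s := n)
      (by linarith [(n.cast_nonneg : (0 : ℝ) ≤ n)])).const_mul a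
    simpa [mul_assoc] using h

/-- The integrand is the derivative of `-p e^{-t²}`, and both functions are integrable. -/
lemma integral_raise_mul_exp_neg_sq (p : ℝ[X]) :
    ∫ t : ℝ, (2 * X * p - derivative p).eval t * Real.exp (-t ^ 2) = 0 := by
  refine integral_eq_zero_of_hasDerivAt_of_integrable
    (f := fun t => -(p.eval t * Real.exp (-t ^ 2))) (fun t => ?_)
    (integrable_eval_mul_exp_neg_sq _) (integrable_eval_mul_exp_neg_sq p).neg
  have h1 := (p.hasDerivAt t).mul ((hasDerivAt_pow 2 t).neg.exp)
  convert! h1.neg using 1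
  simp
  ring

lemma integral_hermitePoly_mul (n m : ℕ) :
    ∫ t : ℝ, (hermitePoly n * hermitePoly m).eval t * Real.exp (-t ^ 2)
      = if n = m then 1 else 0 := by
  -- Adjointness of raising and differentiation: `(2X - D)(pq) = ((2X - D)p) q - p q'` integrates to
  -- zero against the weight. This lowers both indices by one.
  have step (n m : ℕ) : √(2 * ((n : ℝ) + 1)) *
      ∫ t : ℝ, (hermitePoly (n + 1) * hermitePoly m).eval t * Real.exp (-t ^ 2)
      = √(2 * (m : ℝ)) *
      ∫ t : ℝ, (hermitePoly n * hermitePoly (m - 1)).eval t * Real.exp (-t ^ 2) := by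
    have h := integral_raise_mul_exp_neg_sq (hermitePoly n * hermitePoly m)
    have e : 2 * X * (hermitePoly n * hermitePoly m) - derivative (hermitePoly n * hermitePoly m)
        = C √(2 * ((n : ℝ) + 1)) * (hermitePoly (n + 1) * hermitePoly m)
          - C √(2 * (m : ℝ)) * (hermitePoly n * hermitePoly (m - 1)) := by
      rw [← mul_assoc (C _), ← hermitePoly_raise, derivative_mul, derivative_hermitePoly m]
      ring
    rw [e] at h
    simp only [eval_sub, eval_C_mul, sub_mul, mul_assoc (√_)] at h
    rwa [integral_sub ((integrable_eval_mul_exp_neg_sq _).const_mul _)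
      ((integrable_eval_mul_exp_neg_sq _).const_mul _), integral_const_mul, integral_const_mul,
      sub_eq_zero] at h
  induction n generalizing m with
  | zero =>
    cases m with
    | zero =>
      have hg : ∫ t : ℝ, Real.exp (-t ^ 2) = √Real.pi := by
        simpa using integral_gaussian 1
      simp only [hermitePoly, eval_mul, eval_C, integral_const_mul, hg]
      have hp : √√Real.pi ≠ 0 := by positivity
      field_simp
      simp [sq]
    | succ m =>
      have h := step m 0
      simp only [Nat.cast_zero, mul_zero, Real.sqrt_zero, zero_mul, mul_eq_zero] at h
      have hs : √(2 * ((m : ℝ) + 1)) ≠ 0 := by positivity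
      simpa only [mul_comm (hermitePoly 0), Nat.zero_ne_add_one, if_false, Nat.cast_zero, zero_add]
        using h.resolve_left (by positivity)
  | succ n ih =>
    have hs : √(2 * ((n : ℝ) + 1)) ≠ 0 := by positivity
    have h := step n m
    cases m with
    | zero =>
      refine (mul_right_injective₀ hs) (h.trans ?_)
      simp
    | succ m =>
      simp only [Nat.add_sub_cancel, ih] at h
      by_cases hnm : n = m
      · subst hnm
        refine (mul_right_injective₀ hs) (h.trans ?_)
        simp
      · refine (mul_right_injective₀ hs) (h.trans ?_)
        simp [hnm]

lemma hermiteFun_mul (n m : ℕ) (t : ℝ) :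
    hermiteFun n t * hermiteFun m t
      = (hermitePoly n * hermitePoly m).eval t * Real.exp (-t ^ 2) := by
  have : Real.exp (-t ^ 2) = Real.exp (-t ^ 2 / 2) * Real.exp (-t ^ 2 / 2) := by
    rw [← Real.exp_add]; ring_nf
  rw [hermiteFun, hermiteFun, this, eval_mul]
  ring

lemma integrable_hermiteFun_mul (n m : ℕ) :
    Integrable fun t => hermiteFun n t * hermiteFun m t := by
  simpa only [hermiteFun_mul] using integrable_eval_mul_exp_neg_sq _

lemma integral_hermiteFun_mul (n m : ℕ) :
    ∫ t, hermiteFun n t * hermiteFun m t = if n = m then 1 else 0 := by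
  simpa only [hermiteFun_mul] using integral_hermitePoly_mul n m

lemma contDiff_hermiteFun (n : ℕ) : ContDiff ℝ ∞ (hermiteFun n) := by
  have h : ContDiff ℝ ∞ fun t : ℝ => (hermitePoly n).eval t := by
    simpa using (hermitePoly n).contDiff_aeval (R := ℝ) (𝕜 := ℝ) ∞
  unfold hermiteFun
  fun_prop

/-- The raising identity, with the derivative rewritten as a lower Hermite polynomial, is a
three-term recurrence for multiplication by `t`. -/
lemma mul_hermiteFun (n : ℕ) (t : ℝ) :
    t * hermiteFun n t = √(((n : ℝ) + 1) / 2) * hermiteFun (n + 1) t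
      + √((n : ℝ) / 2) * hermiteFun (n - 1) t := by
  have h := congrArg (eval t) (hermitePoly_raise n)
  rw [derivative_hermitePoly] at h
  simp only [eval_sub, eval_mul, eval_C, eval_X, eval_ofNat] at h
  have e (a : ℝ) : √(2 * a) = 2 * √(a / 2) := by
    rw [show 2 * a = 2 ^ 2 * (a / 2) by ring, Real.sqrt_mul (by norm_num),
      Real.sqrt_sq (by norm_num)]
  rw [e, e] at h
  unfold hermiteFun
  linear_combination Real.exp (-t ^ 2 / 2) / 2 * h

lemma hasDerivAt_hermiteFun (n : ℕ) (t : ℝ) :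
    HasDerivAt (hermiteFun n) (√((n : ℝ) / 2) * hermiteFun (n - 1) t
      - √(((n : ℝ) + 1) / 2) * hermiteFun (n + 1) t) t := by
  have h1 := ((hermitePoly n).hasDerivAt t).mul (((hasDerivAt_pow 2 t).neg.div_const 2).exp)
  have e (a : ℝ) : √(2 * a) = 2 * √(a / 2) := by
    rw [show 2 * a = 2 ^ 2 * (a / 2) by ring, Real.sqrt_mul (by norm_num),
      Real.sqrt_sq (by norm_num)]
  have h2 := mul_hermiteFun n t
  convert! h1 using 1
  rw [derivative_hermitePoly, eval_C_mul, e]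
  simp only [hermiteFun] at h2 ⊢
  simp only [Nat.add_one_sub_one, Nat.cast_ofNat, pow_one]
  linear_combination h2

end HermiteFunction

/-! ### Hermite functions in several variables. -/

namespace Heisenberg

open HermiteFunction

variable {N : ℕ}

/-- The multivariate Hermite functions, tensor products of one-dimensional ones. -/
noncomputable def hermiteProd (α : Fin N → ℕ) (x : EuclideanSpace ℝ (Fin N)) : ℝ :=
  ∏ i, hermiteFun (α i) (x i)

lemma hermiteProd_update (α : Fin N → ℕ) (i : Fin N) (k : ℕ) (x : EuclideanSpace ℝ (Fin N)) :
    hermiteProd (Function.update α i k) x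
      = hermiteFun k (x i) * ∏ j ∈ Finset.univ.erase i, hermiteFun (α j) (x j) := by
  rw [hermiteProd, ← Finset.mul_prod_erase _ _ (Finset.mem_univ i), Function.update_self]
  congr 1
  refine Finset.prod_congr rfl fun j hj => ?_
  rw [Function.update_of_ne (Finset.ne_of_mem_erase hj)]

lemma hermiteProd_eq_mul_prod_erase (α : Fin N → ℕ) (i : Fin N)
    (x : EuclideanSpace ℝ (Fin N)) :
    hermiteProd α x
      = hermiteFun (α i) (x i) * ∏ j ∈ Finset.univ.erase i, hermiteFun (α j) (x j) := by
  rw [← hermiteProd_update, Function.update_eq_self]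

lemma contDiff_hermiteProd (α : Fin N → ℕ) : ContDiff ℝ ∞ (hermiteProd α) := by
  unfold hermiteProd
  refine contDiff_prod fun i _ => (contDiff_hermiteFun _).comp ?_
  fun_prop

lemma coord_mul_hermiteProd (α : Fin N → ℕ) (i : Fin N) (x : EuclideanSpace ℝ (Fin N)) :
    x i * hermiteProd α x
      = √(((α i : ℝ) + 1) / 2) * hermiteProd (Function.update α i (α i + 1)) x
        + √((α i : ℝ) / 2) * hermiteProd (Function.update α i (α i - 1)) x := by
  rw [hermiteProd_update, hermiteProd_update, hermiteProd_eq_mul_prod_erase α i, ← mul_assoc,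
    mul_hermiteFun]
  ring

lemma fderiv_hermiteProd (α : Fin N → ℕ) (i : Fin N) (x : EuclideanSpace ℝ (Fin N)) :
    fderiv ℝ (hermiteProd α) x (EuclideanSpace.single i 1)
      = √((α i : ℝ) / 2) * hermiteProd (Function.update α i (α i - 1)) x
        - √(((α i : ℝ) + 1) / 2) * hermiteProd (Function.update α i (α i + 1)) x := by
  have hd : DifferentiableAt ℝ (hermiteProd α) x :=
    (contDiff_hermiteProd α).differentiable (by simp) x
  rw [← hd.lineDeriv_eq_fderiv]
  refine HasLineDerivAt.lineDeriv ?_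
  unfold HasLineDerivAt
  have hl (t : ℝ) : hermiteProd α (x + t • EuclideanSpace.single i 1)
      = hermiteFun (α i) (x i + t) * ∏ j ∈ Finset.univ.erase i, hermiteFun (α j) (x j) := by
    rw [hermiteProd_eq_mul_prod_erase α i]
    congr 1
    · simp
    · refine Finset.prod_congr rfl fun j hj => ?_
      simp [Finset.ne_of_mem_erase hj]
  simp only [hl]
  have h1 := (hasDerivAt_hermiteFun (α i) (x i + 0)).comp_const_add (x i) 0
  convert! h1.mul_const (∏ j ∈ Finset.univ.erase i, hermiteFun (α j) (x j)) using 1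
  rw [hermiteProd_update, hermiteProd_update, add_zero]
  ring

lemma integrable_hermiteProd_mul (α β : Fin N → ℕ) :
    Integrable fun x => hermiteProd α x * hermiteProd β x := by
  simp only [hermiteProd, ← Finset.prod_mul_distrib]
  rw [← (PiLp.volume_preserving_toLp (Fin N)).integrable_comp_emb
    (MeasurableEquiv.toLp 2 _).measurableEmbedding]
  exact Integrable.fintype_prod fun i => integrable_hermiteFun_mul (α i) (β i)

lemma integral_hermiteProd_mul (α β : Fin N → ℕ) :
    ∫ x, hermiteProd α x * hermiteProd β x = if α = β then 1 else 0 := by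
  simp only [hermiteProd, ← Finset.prod_mul_distrib]
  rw [← (PiLp.volume_preserving_toLp (Fin N)).integral_comp
    (MeasurableEquiv.toLp 2 _).measurableEmbedding]
  refine (integral_fintype_prod_volume_eq_prod
    (fun i t => hermiteFun (α i) t * hermiteFun (β i) t)).trans ?_
  simp only [integral_hermiteFun_mul]
  rw [Finset.prod_ite_zero]
  simp [funext_iff]

lemma memLp_hermiteProd (α : Fin N → ℕ) : MemLp (hermiteProd α) 2 := by
  rw [memLp_two_iff_integrable_sq (contDiff_hermiteProd α).continuous.aestronglyMeasurable]
  simpa only [sq] using integrable_hermiteProd_mul α α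

/-- Identifies the line of extremal Gaussians with the span of the basis vector of index `0`. -/
lemma hermiteProd_zero (x : EuclideanSpace ℝ (Fin N)) :
    hermiteProd 0 x = (√√Real.pi)⁻¹ ^ N * gaussian x := by
  simp only [hermiteProd, hermiteFun, hermitePoly, Polynomial.eval_C,
    Finset.prod_mul_distrib, ← Real.exp_sum, gaussian, EuclideanSpace.norm_sq_eq]
  simp [neg_div, Finset.sum_div]

end Heisenberg

/-! ### Completeness of the Hermite functions in `L²`. -/

namespace Heisenberg

open HermiteFunction

variable {N : ℕ}

/-- An integrable function whose Fourier transform vanishes is zero almost everywhere. -/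
lemma ae_eq_zero_of_forall_integral_mul_cexp_eq_zero {E : Type*} [NormedAddCommGroup E]
    [InnerProductSpace ℝ E] [FiniteDimensional ℝ E] [MeasurableSpace E] [BorelSpace E]
    {μ : Measure E} [SigmaFinite μ] {f : E → ℝ} (hf : Integrable f μ)
    (h : ∀ ξ : E, ∫ x, (f x : ℂ) * Complex.exp (inner ℝ x ξ * Complex.I) ∂μ = 0) :
    f =ᵐ[μ] 0 := by
  have fin1 := isFiniteMeasure_withDensity_ofReal hf.2
  have fin2 := isFiniteMeasure_withDensity_ofReal hf.neg.2
  have m1 : AEMeasurable (fun x => ENNReal.ofReal (f x)) μ := hf.aemeasurable.ennreal_ofReal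
  have m2 : AEMeasurable (fun x => ENNReal.ofReal ((-f) x)) μ :=
    hf.neg.aemeasurable.ennreal_ofReal
  have hne (ξ : E) {g : E → ℝ} (hg : Integrable g μ) : Integrable
      (fun x => (max (g x) 0) • Complex.exp (inner ℝ x ξ * Complex.I)) μ := by
    refine Integrable.mono hg.pos_part (.smul hg.pos_part.1 ?_) (.of_forall fun x => ?_)
    · exact Continuous.aestronglyMeasurable (by fun_prop)
    · simp [Complex.norm_exp_ofReal_mul_I]
  -- The positive and negative parts of `f` are densities of finite measures with equal
  -- characteristic functions, so the two measures coincide. Since at each point one of the parts is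
  -- zero, both vanish almost everywhere.
  have key : μ.withDensity (fun x => ENNReal.ofReal (f x))
      = μ.withDensity (fun x => ENNReal.ofReal ((-f) x)) := by
    refine Measure.ext_of_charFun (funext fun ξ => ?_)
    rw [charFun_apply, charFun_apply,
      integral_withDensity_eq_integral_toReal_smul₀ m1 (by simp),
      integral_withDensity_eq_integral_toReal_smul₀ m2 (by simp), ← sub_eq_zero]
    simp only [ENNReal.toReal_ofReal']
    rw [← integral_sub (hne ξ hf) (hne ξ hf.neg), ← h ξ]
    refine integral_congr_ae (.of_forall fun x => ?_)
    simp only [Pi.neg_apply, ← sub_smul, max_zero_sub_eq_self]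
    exact Complex.real_smul
  rw [withDensity_eq_iff m1 m2 hf.lintegral_lt_top.ne] at key
  filter_upwards [key] with x hx
  simp only [Pi.neg_apply] at hx
  rcases le_total 0 (f x) with h0 | h0
  · rw [ENNReal.ofReal_of_nonpos (neg_nonpos.2 h0), ENNReal.ofReal_eq_zero] at hx
    exact le_antisymm hx h0
  · rw [ENNReal.ofReal_of_nonpos h0, eq_comm, ENNReal.ofReal_eq_zero] at hx
    exact le_antisymm h0 (neg_nonpos.1 hx)

lemma memLp_of_mem_span_hermiteProd {f : EuclideanSpace ℝ (Fin N) → ℝ}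
    (hf : f ∈ Submodule.span ℝ (Set.range (hermiteProd (N := N)))) : MemLp f 2 := by
  induction hf using Submodule.span_induction with
  | mem f hf =>
    obtain ⟨α, rfl⟩ := hf
    exact memLp_hermiteProd α
  | zero => exact MemLp.zero
  | add f g _ _ hf hg => exact hf.add hg
  | smul a f _ hf => exact hf.const_smul a

/-- The coordinate recurrence makes the span stable under multiplication by linear forms. This
supplies all the functions `⟨x, ξ⟩^k e^{-|x|²/2}` needed for completeness. -/
lemma inner_mul_mem_span_hermiteProd (ξ : EuclideanSpace ℝ (Fin N))
    {f : EuclideanSpace ℝ (Fin N) → ℝ}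
    (hf : f ∈ Submodule.span ℝ (Set.range (hermiteProd (N := N)))) :
    (fun x => inner ℝ x ξ * f x) ∈ Submodule.span ℝ (Set.range (hermiteProd (N := N))) := by
  induction hf using Submodule.span_induction with
  | mem f hf =>
    obtain ⟨α, rfl⟩ := hf
    have : (fun x => inner ℝ x ξ * hermiteProd α x)
        = ∑ i, ξ i • (√(((α i : ℝ) + 1) / 2) • hermiteProd (Function.update α i (α i + 1))
          + √((α i : ℝ) / 2) • hermiteProd (Function.update α i (α i - 1))) := by
      ext x
      simp only [PiLp.inner_apply, Finset.sum_mul, Finset.sum_apply, Pi.smul_apply, Pi.add_apply,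
        smul_eq_mul, ← coord_mul_hermiteProd]
      simp [mul_assoc]
    rw [this]
    refine Submodule.sum_mem _ fun i _ => Submodule.smul_mem _ _ ?_
    exact Submodule.add_mem _ (Submodule.smul_mem _ _ (Submodule.subset_span ⟨_, rfl⟩))
      (Submodule.smul_mem _ _ (Submodule.subset_span ⟨_, rfl⟩))
  | zero =>
    simp only [Pi.zero_apply, mul_zero]
    exact Submodule.zero_mem _
  | add f g _ _ hf hg => simpa only [Pi.add_apply, mul_add] using! Submodule.add_mem _ hf hg
  | smul a f _ hf =>
    convert! Submodule.smul_mem _ a hf using 1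
    ext x
    simp only [Pi.smul_apply, smul_eq_mul]
    ring

lemma inner_pow_mul_gaussian_mem_span_hermiteProd (ξ : EuclideanSpace ℝ (Fin N)) (k : ℕ) :
    (fun x => inner ℝ x ξ ^ k * gaussian x)
      ∈ Submodule.span ℝ (Set.range (hermiteProd (N := N))) := by
  induction k with
  | zero =>
    have : (fun x : EuclideanSpace ℝ (Fin N) => inner ℝ x ξ ^ 0 * gaussian x)
        = ((√√Real.pi)⁻¹ ^ N)⁻¹ • hermiteProd 0 := by
      ext x
      have hp : √√Real.pi ≠ 0 := by positivity
      rw [Pi.smul_apply, hermiteProd_zero, smul_eq_mul, inv_mul_cancel_left₀ (by positivity),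
        pow_zero, one_mul]
    rw [this]
    exact Submodule.smul_mem _ _ (Submodule.subset_span ⟨_, rfl⟩)
  | succ k ih =>
    simpa only [pow_succ', mul_assoc] using inner_mul_mem_span_hermiteProd ξ ih

/-- Provides the dominating function for integrating the exponential series term by term. -/
lemma memLp_exp_abs_inner_mul_gaussian (ξ : EuclideanSpace ℝ (Fin N)) :
    MemLp (fun x => Real.exp |inner ℝ x ξ| * gaussian x) 2 := by
  have hc : Continuous fun x : EuclideanSpace ℝ (Fin N) =>
      Real.exp |inner ℝ x ξ| * gaussian x := by
    unfold gaussian; fun_prop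
  rw [memLp_two_iff_integrable_sq hc.aestronglyMeasurable]
  have hi : Integrable fun x : EuclideanSpace ℝ (Fin N) =>
      Real.exp (2 * ‖ξ‖ ^ 2) * Real.exp (-(1 / 2) * ‖x‖ ^ 2) := by
    refine Integrable.const_mul ?_ _
    have := (GaussianFourier.integrable_cexp_neg_mul_sq_norm_add (V := EuclideanSpace ℝ (Fin N))
      (b := (1 / 2 : ℂ)) (by norm_num) 0 0).norm
    convert! this using 2 with x
    simp [Complex.norm_exp, ← Complex.ofReal_pow]
  refine hi.mono' (hc.pow 2).aestronglyMeasurable (.of_forall fun x => ?_)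
  rw [Real.norm_of_nonneg (by positivity), mul_pow, gaussian, ← Real.exp_nat_mul,
    ← Real.exp_nat_mul, ← Real.exp_add, ← Real.exp_add, Real.exp_le_exp]
  have h := abs_real_inner_le_norm x ξ
  push_cast
  -- Young's inequality `2‖x‖‖ξ‖ ≤ ‖x‖²/2 + 2‖ξ‖²`, whence the constant `e^{2‖ξ‖²}` above.
  nlinarith [sq_nonneg (‖x‖ - 2 * ‖ξ‖)]

/-- Expanding `e^{i⟨x, ξ⟩}` in its power series, each term of the Fourier integral of `w
e^{-|x|²/2}` pairs `w` with an element of the Hermite span and so vanishes. The Fourier transform is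
therefore zero, and the Gaussian factor never is. -/
lemma ae_eq_zero_of_forall_integral_mul_hermiteProd_eq_zero
    {w : EuclideanSpace ℝ (Fin N) → ℝ} (hw : MemLp w 2)
    (h : ∀ α, ∫ x, w x * hermiteProd α x = 0) : w =ᵐ[volume] 0 := by
  have hspan : ∀ f ∈ Submodule.span ℝ (Set.range (hermiteProd (N := N))),
      ∫ x, w x * f x = 0 := by
    intro f hf
    induction hf using Submodule.span_induction with
    | mem f hf =>
      obtain ⟨α, rfl⟩ := hf
      exact h α
    | zero => simp
    | add f g hfs hgs hf hg =>
      simp only [Pi.add_apply, mul_add]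
      refine (integral_add (hw.integrable_mul (memLp_of_mem_span_hermiteProd hfs))
        (hw.integrable_mul (memLp_of_mem_span_hermiteProd hgs))).trans ?_
      simp only [Pi.mul_apply, hf, hg, add_zero]
    | smul a f _ hf =>
      simp only [Pi.smul_apply, smul_eq_mul, mul_left_comm _ a]
      rw [integral_const_mul, hf, mul_zero]
  have hexp (ξ : EuclideanSpace ℝ (Fin N)) :
      Integrable fun x => w x * (Real.exp |inner ℝ x ξ| * gaussian x) :=
    hw.integrable_mul (memLp_exp_abs_inner_mul_gaussian ξ)
  have hwg : Integrable fun x => w x * gaussian x := by simpa using hexp 0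
  have hz : (fun x => w x * gaussian x) =ᵐ[volume] 0 := by
    refine ae_eq_zero_of_forall_integral_mul_cexp_eq_zero hwg fun ξ => ?_
    have hnorm (x : EuclideanSpace ℝ (Fin N)) :
        HasSum (fun k : ℕ => |w x| * gaussian x * (|inner ℝ x ξ| ^ k / k.factorial))
          (|w x| * gaussian x * Real.exp |inner ℝ x ξ|) := by
      rw [Real.exp_eq_exp_ℝ]
      exact (NormedSpace.expSeries_div_hasSum_exp (𝔸 := ℝ) _).mul_left _
    have hsum := hasSum_integral_of_dominated_convergence
      (F := fun (k : ℕ) (x : EuclideanSpace ℝ (Fin N)) =>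
        ((w x * gaussian x : ℝ) : ℂ) * ((inner ℝ x ξ * Complex.I) ^ k / k.factorial))
      (f := fun x => ((w x * gaussian x : ℝ) : ℂ) * Complex.exp (inner ℝ x ξ * Complex.I))
      (μ := volume)
      (fun k x => |w x| * gaussian x * (|inner ℝ x ξ| ^ k / k.factorial))
      (fun k => ?_) (fun k => .of_forall fun x => ?_) (.of_forall fun x => (hnorm x).summable)
      ?_ (.of_forall fun x => ?_)
    · refine hsum.unique ?_
      convert! hasSum_zero (α := ℂ) (β := ℕ) using 1
      funext k
      have e (x : EuclideanSpace ℝ (Fin N)) :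
          ((w x * gaussian x : ℝ) : ℂ) * ((inner ℝ x ξ * Complex.I) ^ k / k.factorial)
            = ((w x * (inner ℝ x ξ ^ k * gaussian x) : ℝ) : ℂ)
              * (Complex.I ^ k / k.factorial) := by
        push_cast
        ring
      simp only [e]
      rw [integral_mul_const, integral_complex_ofReal,
        hspan _ (inner_pow_mul_gaussian_mem_span_hermiteProd ξ k)]
      simp
    · refine (Complex.continuous_ofReal.comp_aestronglyMeasurable hwg.1).mul ?_
      exact Continuous.aestronglyMeasurable (by fun_prop)
    · have : |gaussian x| = gaussian x := abs_of_pos (Real.exp_pos _)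
      simp [this]
    · simp only [(hnorm _).tsum_eq]
      convert! (hexp ξ).norm using 2 with x
      have : |gaussian x| = gaussian x := abs_of_pos (Real.exp_pos _)
      simp [this]
      ring
    · rw [Complex.exp_eq_exp_ℂ]
      exact (NormedSpace.expSeries_div_hasSum_exp (𝔸 := ℂ) _).mul_left _
  filter_upwards [hz] with x hx
  exact (mul_eq_zero.1 hx).resolve_right (Real.exp_pos _).ne'

/-- The Hermite functions as a Hilbert basis of `L²(ℝ^N)`. -/
noncomputable def hermiteBasis (N : ℕ) :
    HilbertBasis (Fin N → ℕ) ℝ (Lp ℝ 2 (volume : Measure (EuclideanSpace ℝ (Fin N)))) :=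
  HilbertBasis.mkOfOrthogonalEqBot (v := fun α => (memLp_hermiteProd α).toLp _)
    (by
      classical
      rw [orthonormal_iff_ite]
      intro α β
      rw [L2.inner_def, ← integral_hermiteProd_mul α β]
      refine integral_congr_ae ?_
      filter_upwards [(memLp_hermiteProd α).coeFn_toLp, (memLp_hermiteProd β).coeFn_toLp]
        with x h1 h2
      rw [h1, h2]
      simp [mul_comm])
    (by
      rw [Submodule.eq_bot_iff]
      intro w hw
      rw [Lp.eq_zero_iff_ae_eq_zero]
      refine ae_eq_zero_of_forall_integral_mul_hermiteProd_eq_zero (Lp.memLp w) fun α => ?_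
      have := Submodule.mem_orthogonal _ _ |>.1 hw _ (Submodule.subset_span ⟨α, rfl⟩)
      rw [L2.inner_def] at this
      rw [← this]
      refine integral_congr_ae ?_
      filter_upwards [(memLp_hermiteProd α).coeFn_toLp] with x h1
      rw [h1]
      simp)

/-- Parseval's identity for the Hermite functions. -/
lemma hasSum_integral_mul_hermiteProd {u v : EuclideanSpace ℝ (Fin N) → ℝ}
    (hu : MemLp u 2) (hv : MemLp v 2) :
    HasSum (fun α => (∫ x, u x * hermiteProd α x) * ∫ x, v x * hermiteProd α x)
      (∫ x, u x * v x) := by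
  have hin {f g : EuclideanSpace ℝ (Fin N) → ℝ} (hf : MemLp f 2) (hg : MemLp g 2) :
      inner ℝ (hf.toLp f) (hg.toLp g) = ∫ x, f x * g x := by
    rw [L2.inner_def]
    refine integral_congr_ae ?_
    filter_upwards [hf.coeFn_toLp, hg.coeFn_toLp] with x h1 h2
    rw [h1, h2]
    simp [mul_comm]
  have h := (hermiteBasis N).hasSum_inner_mul_inner (hu.toLp u) (hv.toLp v)
  rw [hin] at h
  have hb (α : Fin N → ℕ) : hermiteBasis N α = (memLp_hermiteProd α).toLp _ := by
    simp [hermiteBasis]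
  convert! h using 2 with α
  rw [hb, hin, hin]
  simp only [mul_comm]

end Heisenberg

/-! ### Calculus of weak gradients. -/

namespace Heisenberg

open Filter Topology

variable {N : ℕ} {u v m : EuclideanSpace ℝ (Fin N) → ℝ}
  {G H M : EuclideanSpace ℝ (Fin N) → EuclideanSpace ℝ (Fin N)}

lemma integrable_mul_of_hasCompactSupport {φ f : EuclideanSpace ℝ (Fin N) → ℝ}
    (hφ : Continuous φ) (hs : HasCompactSupport φ) (hf : LocallyIntegrable f) :
    Integrable fun x => φ x * f x :=
  hf.integrable_smul_left_of_hasCompactSupport hφ hs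

lemma locallyIntegrable_coord (hG : LocallyIntegrable G) (i : Fin N) :
    LocallyIntegrable fun x => G x i := fun x =>
  let ⟨s, hs, h⟩ := hG x
  ⟨s, hs, (EuclideanSpace.proj i : EuclideanSpace ℝ (Fin N) →L[ℝ] ℝ).integrable_comp h⟩

lemma memLp_coord (hG : MemLp G 2) (i : Fin N) : MemLp (fun x => G x i) 2 :=
  (EuclideanSpace.proj i : EuclideanSpace ℝ (Fin N) →L[ℝ] ℝ).comp_memLp' hG

lemma contDiff_fderiv_apply {φ : EuclideanSpace ℝ (Fin N) → ℝ} (hφ : ContDiff ℝ ∞ φ)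
    (v : EuclideanSpace ℝ (Fin N)) : ContDiff ℝ ∞ fun x => fderiv ℝ φ x v :=
  (hφ.fderiv_right (m := ∞) (by simp)).clm_apply contDiff_const

lemma HasWeakGradient.ae_eq (hG : HasWeakGradient u G) (hH : HasWeakGradient u H) :
    G =ᵐ[volume] H := by
  have h (i : Fin N) : ∀ᵐ x, G x i = H x i := by
    refine ae_eq_of_integral_contDiff_smul_eq (locallyIntegrable_coord hG.2.1 i)
      (locallyIntegrable_coord hH.2.1 i) fun φ hφ hs => ?_
    have h1 := hG.2.2 φ hφ hs i
    rw [hH.2.2 φ hφ hs i, neg_inj] at h1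
    exact h1.symm
  filter_upwards [ae_all_iff.2 h] with x hx
  ext i
  exact hx i

/-- `weakGradient` is an arbitrary choice; uniqueness lets any explicit weak gradient replace it
under an integral. -/
lemma HasWeakGradient.weakGradient_ae_eq (hG : HasWeakGradient u G) :
    weakGradient u =ᵐ[volume] G := by
  have hu : WeaklyDifferentiable u := ⟨G, hG⟩
  rw [weakGradient, dif_pos hu]
  exact hu.choose_spec.ae_eq hG

/-- A smooth function has its classical gradient as weak gradient. -/
lemma hasWeakGradient_of_contDiff (hm : ContDiff ℝ ∞ m) (hM : Continuous M)
    (hmM : ∀ x i, fderiv ℝ m x (EuclideanSpace.single i 1) = M x i) :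
    HasWeakGradient m M := by
  refine ⟨hm.continuous.locallyIntegrable, hM.locallyIntegrable, fun φ hφ hs i => ?_⟩
  have hMi : Continuous fun x => M x i := by fun_prop
  have hdi := contDiff_fderiv_apply hφ (EuclideanSpace.single i 1)
  rw [integral_mul_fderiv_eq_neg_fderiv_mul_of_integrable]
  · simp only [hmM, mul_comm]
  · simp only [hmM]
    exact (hMi.mul hφ.continuous).integrable_of_hasCompactSupport hs.mul_left
  · exact (hm.continuous.mul hdi.continuous).integrable_of_hasCompactSupport
      (hs.fderiv_apply ℝ _).mul_left
  · exact (hm.continuous.mul hφ.continuous).integrable_of_hasCompactSupport hs.mul_left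
  · exact fun x _ => hm.differentiable (by simp) x
  · exact fun x _ => hφ.differentiable (by simp) x

/-- Leibniz rule for the product of a weakly differentiable and a smooth function. -/
lemma HasWeakGradient.mul_contDiff (hu : HasWeakGradient u G) (hm : ContDiff ℝ ∞ m)
    (hM : Continuous M) (hmM : ∀ x i, fderiv ℝ m x (EuclideanSpace.single i 1) = M x i) :
    HasWeakGradient (fun x => u x * m x) (fun x => m x • G x + u x • M x) := by
  refine ⟨?_, ?_, fun φ hφ hs i => ?_⟩
  · exact (locallyIntegrableOn_univ.1 <| (locallyIntegrableOn_univ.2 hu.1).mul_continuousOn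
      hm.continuous.continuousOn isOpen_univ.isLocallyClosed)
  · refine LocallyIntegrable.add ?_ ?_
    · exact (locallyIntegrableOn_univ.1 <|
        (locallyIntegrableOn_univ.2 hu.2.1).continuousOn_smul isOpen_univ.isLocallyClosed
          hm.continuous.continuousOn)
    · exact (locallyIntegrableOn_univ.1 <|
        (locallyIntegrableOn_univ.2 hu.1).smul_continuousOn
          isOpen_univ.isLocallyClosed hM.continuousOn)
  · have hdi := contDiff_fderiv_apply hφ (EuclideanSpace.single i 1)
    have hMi : Continuous fun x => M x i := by fun_prop
    -- The product `m φ` is again a test function, and the classical Leibniz rule for it yields the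
    -- weak one.
    have h := hu.2.2 (fun x => m x * φ x) (hm.mul hφ) hs.mul_left i
    have hd (x : EuclideanSpace ℝ (Fin N)) :
        fderiv ℝ (fun x => m x * φ x) x (EuclideanSpace.single i 1)
          = m x * fderiv ℝ φ x (EuclideanSpace.single i 1) + φ x * M x i := by
      rw [fderiv_fun_mul (hm.differentiable (by simp) x) (hφ.differentiable (by simp) x)]
      simp [hmM]
    have i1 : Integrable fun x => u x * m x * fderiv ℝ φ x (EuclideanSpace.single i 1) := by
      convert! integrable_mul_of_hasCompactSupport (hm.continuous.mul hdi.continuous)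
        (hs.fderiv_apply ℝ (EuclideanSpace.single i 1)).mul_left hu.1 using 2
      simp only [Pi.mul_apply]
      ring
    have i2 : Integrable fun x => u x * (φ x * M x i) := by
      convert! integrable_mul_of_hasCompactSupport (hφ.continuous.mul hMi) hs.mul_right hu.1 using 2
      simp only [Pi.mul_apply]
      ring
    have i3 : Integrable fun x => m x * φ x * G x i :=
      integrable_mul_of_hasCompactSupport (hm.continuous.mul hφ.continuous) hs.mul_left
        (locallyIntegrable_coord hu.2.1 i)
    simp only [hd, mul_add, ← mul_assoc (u _) (m _)] at h
    rw [integral_add i1 i2] at h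
    rw [eq_sub_of_add_eq h, ← neg_add', ← integral_add i3 i2]
    congr 1
    refine integral_congr_ae (.of_forall fun x => ?_)
    simp only [PiLp.add_apply, PiLp.smul_apply, smul_eq_mul]
    ring

lemma HasWeakGradient.sub_const_mul (hu : HasWeakGradient u G) (hv : HasWeakGradient v H)
    (c : ℝ) : HasWeakGradient (fun x => u x - c * v x) (fun x => G x - c • H x) := by
  refine ⟨hu.1.sub (hv.1.smul c), hu.2.1.sub (hv.2.1.smul c), fun φ hφ hs i => ?_⟩
  have hdi := contDiff_fderiv_apply hφ (EuclideanSpace.single i 1)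
  have i1 {w : EuclideanSpace ℝ (Fin N) → ℝ} (hw : LocallyIntegrable w) :
      Integrable fun x => w x * fderiv ℝ φ x (EuclideanSpace.single i 1) := by
    simpa only [mul_comm] using integrable_mul_of_hasCompactSupport hdi.continuous
      (hs.fderiv_apply ℝ (EuclideanSpace.single i 1)) hw
  have i2 {K : EuclideanSpace ℝ (Fin N) → EuclideanSpace ℝ (Fin N)} (hK : LocallyIntegrable K) :
      Integrable fun x => φ x * K x i :=
    integrable_mul_of_hasCompactSupport hφ.continuous hs (locallyIntegrable_coord hK i)
  simp only [sub_mul, mul_assoc, PiLp.sub_apply, PiLp.smul_apply, smul_eq_mul, mul_sub,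
    mul_left_comm _ c]
  rw [integral_sub (i1 hu.1) ((i1 hv.1).const_mul c), integral_sub (i2 hu.2.1)
    ((i2 hv.2.1).const_mul c), integral_const_mul, integral_const_mul, hu.2.2 φ hφ hs i,
    hv.2.2 φ hφ hs i]
  ring

/-- For `L²` functions, the definition of weak gradient extends to smooth test functions that
are square integrable together with their derivative. -/
lemma HasWeakGradient.integral_mul_fderiv (hu : HasWeakGradient u G) (hu2 : MemLp u 2)
    (hG2 : MemLp G 2) {ψ : EuclideanSpace ℝ (Fin N) → ℝ} (hψ : ContDiff ℝ ∞ ψ)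
    (hψ2 : MemLp ψ 2) (i : Fin N)
    (hdψ : MemLp (fun x => fderiv ℝ ψ x (EuclideanSpace.single i 1)) 2) :
    ∫ x, u x * fderiv ℝ ψ x (EuclideanSpace.single i 1) = - ∫ x, ψ x * G x i := by
  -- Cut off `ψ` by `b (r n • x)` with `r n = 1 / (n + 1)`. The cutoffs tend to `1` pointwise, and
  -- their derivatives are bounded by `r n * C`, hence tend to `0` and stay below `C`.
  let b : ContDiffBump (0 : EuclideanSpace ℝ (Fin N)) := ⟨1, 2, one_pos, one_lt_two⟩
  have hb : ContDiff ℝ ∞ b := b.contDiff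
  let e : EuclideanSpace ℝ (Fin N) := EuclideanSpace.single i 1
  obtain ⟨C, hC⟩ := (b.hasCompactSupport.fderiv_apply ℝ e).exists_bound_of_continuous
    (contDiff_fderiv_apply hb e).continuous
  let r : ℕ → ℝ := fun n => 1 / ((n : ℝ) + 1)
  have hr (n : ℕ) : 0 < r n := Nat.one_div_pos_of_nat
  have hr1 (n : ℕ) : r n ≤ 1 := by
    simp only [r]
    rw [div_le_one (by positivity)]
    linarith [(n.cast_nonneg : (0 : ℝ) ≤ n)]
  have hr0 : Tendsto r atTop (𝓝 0) := tendsto_one_div_add_atTop_nhds_zero_nat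
  have hχ (n : ℕ) : ContDiff ℝ ∞ fun x => b (r n • x) := hb.comp (contDiff_const_smul (r n))
  have hχs (n : ℕ) : HasCompactSupport fun x => b (r n • x) :=
    b.hasCompactSupport.comp_smul (hr n).ne'
  have hχd (n : ℕ) (x : EuclideanSpace ℝ (Fin N)) :
      fderiv ℝ (fun x => b (r n • x)) x e = r n * fderiv ℝ b (r n • x) e := by
    rw [fderiv_comp_smul]
    simp
  have hχ1 (x : EuclideanSpace ℝ (Fin N)) : Tendsto (fun n => b (r n • x)) atTop (𝓝 1) := by
    have h1 : Tendsto (fun n => b (r n • x)) atTop (𝓝 (b ((0 : ℝ) • x))) :=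
      (b.continuous.tendsto _).comp (hr0.smul_const x)
    rwa [zero_smul, b.one_of_mem_closedBall (by simp [b.rIn_pos.le])] at h1
  have hχd0 (x : EuclideanSpace ℝ (Fin N)) :
      Tendsto (fun n => fderiv ℝ (fun x => b (r n • x)) x e) atTop (𝓝 0) := by
    simp only [hχd]
    have : Tendsto (fun n => r n * C) atTop (𝓝 0) := by simpa using hr0.mul_const C
    refine squeeze_zero_norm (fun n => ?_) this
    rw [norm_mul, Real.norm_of_nonneg (hr n).le]
    exact mul_le_mul_of_nonneg_left (hC _) (hr n).le
  have hd (n : ℕ) (x : EuclideanSpace ℝ (Fin N)) :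
      fderiv ℝ (fun x => b (r n • x) * ψ x) x e
        = b (r n • x) * fderiv ℝ ψ x e + ψ x * fderiv ℝ (fun x => b (r n • x)) x e := by
    rw [fderiv_fun_mul ((hχ n).differentiable (by simp) x) (hψ.differentiable (by simp) x)]
    simp
  have hb1 (y : EuclideanSpace ℝ (Fin N)) : |b y| ≤ 1 := by
    rw [abs_of_nonneg b.nonneg]; exact b.le_one
  have hG2i := memLp_coord hG2 i
  have hL : Tendsto (fun n => ∫ x, u x * fderiv ℝ (fun x => b (r n • x) * ψ x) x e) atTop
      (𝓝 (∫ x, u x * fderiv ℝ ψ x e)) := by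
    refine tendsto_integral_of_dominated_convergence
      (fun x => ‖u x * fderiv ℝ ψ x e‖ + C * ‖u x * ψ x‖) (fun n => ?_) ?_
      (fun n => .of_forall fun x => ?_) (.of_forall fun x => ?_)
    · exact hu2.1.mul
        (contDiff_fderiv_apply ((hχ n).mul hψ) e).continuous.aestronglyMeasurable
    · exact (hu2.integrable_mul hdψ).norm.add ((hu2.integrable_mul hψ2).norm.const_mul C)
    · have h1 : |fderiv ℝ (fun x => b (r n • x)) x e| ≤ C := by
        rw [hχd, abs_mul, abs_of_pos (hr n)]
        exact (mul_le_of_le_one_left (abs_nonneg _) (hr1 n)).trans (hC _)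
      rw [hd, mul_add]
      refine (norm_add_le _ _).trans (add_le_add ?_ ?_)
      · simp only [norm_mul, Real.norm_eq_abs]
        gcongr
        exact mul_le_of_le_one_left (abs_nonneg _) (hb1 _)
      · simp only [norm_mul, Real.norm_eq_abs]
        linarith [mul_le_mul_of_nonneg_left h1 (by positivity : 0 ≤ |u x| * |ψ x|)]
    · simp only [hd]
      have h1 := ((hχ1 x).mul_const (fderiv ℝ ψ x e)).add ((hχd0 x).const_mul (ψ x))
      simpa using h1.const_mul (u x)
  have hR : Tendsto (fun n => - ∫ x, (b (r n • x) * ψ x) * G x i) atTop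
      (𝓝 (- ∫ x, ψ x * G x i)) := by
    refine (tendsto_integral_of_dominated_convergence
      (fun x => ‖ψ x * G x i‖) (fun n => ?_) (hψ2.integrable_mul hG2i).norm
      (fun n => .of_forall fun x => ?_) (.of_forall fun x => ?_)).neg
    · exact ((hχ n).mul hψ).continuous.aestronglyMeasurable.mul hG2i.1
    · simp only [norm_mul, Real.norm_eq_abs]
      gcongr
      exact mul_le_of_le_one_left (abs_nonneg _) (hb1 _)
    · simpa using ((hχ1 x).mul_const (ψ x)).mul_const (G x i)
  refine tendsto_nhds_unique hL (hR.congr fun n => ?_)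
  exact (hu.2.2 _ ((hχ n).mul hψ) (hχs n).mul_right i).symm

end Heisenberg

/-! ### Creation and annihilation operators, and the Gaussian Poincaré inequality. -/

namespace Heisenberg

variable {N : ℕ} {u : EuclideanSpace ℝ (Fin N) → ℝ}
  {G : EuclideanSpace ℝ (Fin N) → EuclideanSpace ℝ (Fin N)}

/-- A sum over multi-indices of terms vanishing for `α i = 0` may be shifted by one in the
coordinate `i`. -/
lemma hasSum_shift_iff (i : Fin N) {f : (Fin N → ℕ) → ℝ} {S : ℝ}
    (hf : ∀ α, α i = 0 → f α = 0) :
    HasSum (fun α => f (Function.update α i (α i + 1))) S ↔ HasSum f S := by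
  have hinj : Function.Injective fun α : Fin N → ℕ => Function.update α i (α i + 1) := by
    intro α β h
    funext j
    have hj := congrFun h j
    by_cases hji : j = i
    · subst hji
      simpa using hj
    · simpa [hji] using hj
  refine hinj.hasSum_iff (f := f) fun α hα => hf α ?_
  by_contra h0
  refine hα ⟨Function.update α i (α i - 1), ?_⟩
  simp [Nat.sub_add_cancel (Nat.one_le_iff_ne_zero.2 h0)]

lemma memLp_fderiv_hermiteProd (α : Fin N → ℕ) (i : Fin N) :
    MemLp (fun x => fderiv ℝ (hermiteProd α) x (EuclideanSpace.single i 1)) 2 := by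
  simp only [fderiv_hermiteProd]
  exact ((memLp_hermiteProd _).const_mul _).sub ((memLp_hermiteProd _).const_mul _)

lemma integral_coord_mul_hermiteProd (hu : MemLp u 2) (α : Fin N → ℕ) (i : Fin N) :
    ∫ x, u x * x i * hermiteProd α x
      = √(((α i : ℝ) + 1) / 2) * (∫ x, u x * hermiteProd (Function.update α i (α i + 1)) x)
        + √((α i : ℝ) / 2) * ∫ x, u x * hermiteProd (Function.update α i (α i - 1)) x := by
  have hi (β : Fin N → ℕ) (c : ℝ) : Integrable fun x => c * (u x * hermiteProd β x) :=
    (hu.integrable_mul (memLp_hermiteProd β)).const_mul c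
  simp only [mul_assoc, coord_mul_hermiteProd, mul_add, mul_left_comm (u _)]
  rw [integral_add (hi _ _) (hi _ _), integral_const_mul, integral_const_mul]

/-- The Hermite function itself serves as test function. Compared with the formula for `x_i u`, only
the sign of the lower neighbour changes, so sum and difference each retain one neighbour. -/
lemma HasWeakGradient.integral_coord_mul_hermiteProd (hG : HasWeakGradient u G)
    (hu : MemLp u 2) (hG2 : MemLp G 2) (α : Fin N → ℕ) (i : Fin N) :
    ∫ x, G x i * hermiteProd α x
      = √(((α i : ℝ) + 1) / 2) * (∫ x, u x * hermiteProd (Function.update α i (α i + 1)) x)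
        - √((α i : ℝ) / 2) * ∫ x, u x * hermiteProd (Function.update α i (α i - 1)) x := by
  have hi (β : Fin N → ℕ) (c : ℝ) : Integrable fun x => c * (u x * hermiteProd β x) :=
    (hu.integrable_mul (memLp_hermiteProd β)).const_mul c
  have h := hG.integral_mul_fderiv hu hG2 (contDiff_hermiteProd α) (memLp_hermiteProd α) i
    (memLp_fderiv_hermiteProd α i)
  simp only [fderiv_hermiteProd, mul_sub, mul_left_comm (u _)] at h
  rw [integral_sub (hi _ _) (hi _ _), integral_const_mul, integral_const_mul] at h
  simp only [mul_comm (hermiteProd _ _)] at h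
  linarith

/-- The coefficient of `x_i u + ∂_i u` at `α` is `2 √((α_i + 1) / 2) û(α + e_i)`. Parseval gives the
sum of the squares, and reindexing by `α + e_i` loses only terms with weight `α_i = 0`. -/
lemma HasWeakGradient.hasSum_annihilation (hG : HasWeakGradient u G) (hu : MemLp u 2)
    (hxu : MemLp (fun x => u x • x) 2) (hG2 : MemLp G 2) (i : Fin N) :
    HasSum (fun α => 2 * (α i : ℝ) * (∫ x, u x * hermiteProd α x) ^ 2)
      (∫ x, (u x * x i + G x i) ^ 2) := by
  have h1 : MemLp (fun x => u x * x i) 2 := memLp_coord hxu i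
  have h2 := memLp_coord hG2 i
  have h := hasSum_integral_mul_hermiteProd (h1.add h2) (h1.add h2)
  have i1 (α : Fin N → ℕ) : Integrable fun x => u x * x i * hermiteProd α x :=
    h1.integrable_mul (memLp_hermiteProd α)
  have i2 (α : Fin N → ℕ) : Integrable fun x => G x i * hermiteProd α x :=
    h2.integrable_mul (memLp_hermiteProd α)
  rw [← hasSum_shift_iff i (by simp +contextual)]
  convert! h using 1
  · funext α
    simp only [Pi.add_apply, add_mul]
    rw [integral_add (i1 α) (i2 α), Heisenberg.integral_coord_mul_hermiteProd hu,
      hG.integral_coord_mul_hermiteProd hu hG2]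
    have hs : √(((α i : ℝ) + 1) / 2) * √(((α i : ℝ) + 1) / 2) = ((α i : ℝ) + 1) / 2 :=
      Real.mul_self_sqrt (by positivity)
    simp only [Function.update_self]
    push_cast
    linear_combination
      (-4) * (∫ x, u x * hermiteProd (Function.update α i (α i + 1)) x) ^ 2 * hs
  · simp only [sq, Pi.add_apply]

/-- The coefficient of `x_i u - ∂_i u` at `α` is `2 √(α_i / 2) û(α - e_i)`. It vanishes for `α_i =
0`, so the Parseval sum may be shifted up by `e_i`. -/
lemma HasWeakGradient.hasSum_creation (hG : HasWeakGradient u G) (hu : MemLp u 2)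
    (hxu : MemLp (fun x => u x • x) 2) (hG2 : MemLp G 2) (i : Fin N) :
    HasSum (fun α => 2 * ((α i : ℝ) + 1) * (∫ x, u x * hermiteProd α x) ^ 2)
      (∫ x, (u x * x i - G x i) ^ 2) := by
  have h1 : MemLp (fun x => u x * x i) 2 := memLp_coord hxu i
  have h2 := memLp_coord hG2 i
  have h := hasSum_integral_mul_hermiteProd (h1.sub h2) (h1.sub h2)
  have i1 (α : Fin N → ℕ) : Integrable fun x => u x * x i * hermiteProd α x :=
    h1.integrable_mul (memLp_hermiteProd α)
  have i2 (α : Fin N → ℕ) : Integrable fun x => G x i * hermiteProd α x :=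
    h2.integrable_mul (memLp_hermiteProd α)
  have e (α : Fin N → ℕ) : ∫ x, ((fun x => u x * x i) - fun x => G x i) x * hermiteProd α x
      = 2 * √((α i : ℝ) / 2)
        * ∫ x, u x * hermiteProd (Function.update α i (α i - 1)) x := by
    simp only [Pi.sub_apply, sub_mul]
    rw [integral_sub (i1 α) (i2 α), Heisenberg.integral_coord_mul_hermiteProd hu,
      hG.integral_coord_mul_hermiteProd hu hG2]
    ring
  simp only [e] at h
  rw [← hasSum_shift_iff i (by simp +contextual)] at h
  convert! h using 1
  · funext α
    have hs : √(((α i : ℝ) + 1) / 2) * √(((α i : ℝ) + 1) / 2) = ((α i : ℝ) + 1) / 2 :=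
      Real.mul_self_sqrt (by positivity)
    simp only [Function.update_self, Nat.add_sub_cancel, Function.update_idem,
      Function.update_eq_self]
    push_cast
    linear_combination (-4) * (∫ x, u x * hermiteProd α x) ^ 2 * hs
  · simp only [sq, Pi.sub_apply]

lemma integral_norm_sq_eq_sum (hG2 : MemLp G 2) :
    ∫ x, ‖G x‖ ^ 2 = ∑ i, ∫ x, G x i ^ 2 := by
  rw [← integral_finsetSum _ fun i _ => (memLp_coord hG2 i).integrable_sq]
  simp only [EuclideanSpace.norm_sq_eq, Real.norm_eq_abs, sq_abs]

/-- Completing the square: `∫ |∇u + x u|² = ∫ |∇u|² + ∫ |x|²u² - N ∫ u²`. -/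
lemma HasWeakGradient.integral_norm_add_sq (hG : HasWeakGradient u G) (hu : MemLp u 2)
    (hxu : MemLp (fun x => u x • x) 2) (hG2 : MemLp G 2) :
    ∫ x, ‖u x • x + G x‖ ^ 2
      = (∫ x, ‖G x‖ ^ 2) + (∫ x, ‖u x • x‖ ^ 2) - N * ∫ x, u x ^ 2 := by
  rw [integral_norm_sq_eq_sum (G := fun x => u x • x + G x) (hxu.add hG2),
    integral_norm_sq_eq_sum hG2, integral_norm_sq_eq_sum hxu]
  have key (i : Fin N) : ∫ x, (u x • x + G x) i ^ 2
      = (∫ x, G x i ^ 2) + (∫ x, (u x • x) i ^ 2) - ∫ x, u x ^ 2 := by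
    have h1 : MemLp (fun x => u x * x i) 2 := memLp_coord hxu i
    have h2 := memLp_coord hG2 i
    have hp := hasSum_integral_mul_hermiteProd hu hu
    -- Termwise the two series differ by `2 û(α)²`. By Parseval this is the integration by parts `2
    -- ∫ u x_i ∂_i u = -∫ u²`.
    have hs := (hG.hasSum_creation hu hxu hG2 i).sub (hG.hasSum_annihilation hu hxu hG2 i)
    have hd := hs.unique (a₂ := 2 * ∫ x, u x * u x) (by
      convert! hp.mul_left 2 using 2
      ring)
    have hpar : (∫ x, (u x * x i - G x i) ^ 2) + ∫ x, (u x * x i + G x i) ^ 2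
        = 2 * (∫ x, (u x * x i) ^ 2) + 2 * ∫ x, G x i ^ 2 := by
      have j1 : Integrable fun x => (u x * x i - G x i) ^ 2 := (h1.sub h2).integrable_sq
      have j2 : Integrable fun x => (u x * x i + G x i) ^ 2 := (h1.add h2).integrable_sq
      rw [← integral_const_mul, ← integral_const_mul, ← integral_add j1 j2,
        ← integral_add (h1.integrable_sq.const_mul 2) (h2.integrable_sq.const_mul 2)]
      refine integral_congr_ae (.of_forall fun x => ?_)
      simp only
      ring
    simp only [← sq] at hd
    simp only [PiLp.add_apply, PiLp.smul_apply, smul_eq_mul]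
    linarith
  simp only [key, Finset.sum_sub_distrib, Finset.sum_add_distrib, Finset.sum_const,
    Finset.card_univ, Fintype.card_fin, nsmul_eq_mul]

/-- The Gaussian Poincaré inequality, in `L²` of Lebesgue measure. -/
lemma HasWeakGradient.two_mul_le_integral_norm_add_sq (hG : HasWeakGradient u G)
    (hu : MemLp u 2) (hxu : MemLp (fun x => u x • x) 2) (hG2 : MemLp G 2) :
    2 * ((∫ x, u x ^ 2) - (∫ x, u x * hermiteProd 0 x) ^ 2)
      ≤ ∫ x, ‖u x • x + G x‖ ^ 2 := by
  classical
  rw [integral_norm_sq_eq_sum (G := fun x => u x • x + G x) (hxu.add hG2)]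
  have hs := hasSum_sum (s := Finset.univ) fun i _ => hG.hasSum_annihilation hu hxu hG2 i
  have hp := hasSum_integral_mul_hermiteProd hu hu
  -- Parseval without its `α = 0` term is compared termwise with `∑ 2 |α| û(α)²`, since `|α| ≥ 1`
  -- for every other `α`.
  have hd := (hp.sub (hasSum_ite_eq (0 : Fin N → ℕ)
    ((∫ x, u x * hermiteProd 0 x) ^ 2))).mul_left 2
  simp only [← sq] at hd
  refine hasSum_le (fun α => ?_) hd hs
  split_ifs with h0
  · subst h0
    simp
  · rw [sub_zero, ← Finset.sum_mul, ← Finset.mul_sum]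
    gcongr
    obtain ⟨i, hi⟩ := Function.ne_iff.1 h0
    have h1 : (1 : ℝ) ≤ α i := by exact_mod_cast Nat.one_le_iff_ne_zero.2 hi
    have h2 : (α i : ℝ) ≤ ∑ j, (α j : ℝ) :=
      Finset.single_le_sum (f := fun j => (α j : ℝ)) (fun j _ => Nat.cast_nonneg _)
        (Finset.mem_univ i)
    linarith

end Heisenberg

/-! ### The deficit as a sum of squares, and the stability inequality. -/

namespace Heisenberg

open HermiteFunction

variable {N : ℕ} {u : EuclideanSpace ℝ (Fin N) → ℝ}
  {G : EuclideanSpace ℝ (Fin N) → EuclideanSpace ℝ (Fin N)}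

lemma contDiff_exp_norm_sq (a : ℝ) :
    ContDiff ℝ ∞ fun x : EuclideanSpace ℝ (Fin N) => Real.exp (a * ‖x‖ ^ 2 / 2) :=
  ((contDiff_const.mul (contDiff_norm_sq ℝ)).div_const 2).exp

lemma fderiv_exp_norm_sq (a : ℝ) (x : EuclideanSpace ℝ (Fin N)) (i : Fin N) :
    fderiv ℝ (fun x : EuclideanSpace ℝ (Fin N) => Real.exp (a * ‖x‖ ^ 2 / 2)) x
      (EuclideanSpace.single i 1) = (a * Real.exp (a * ‖x‖ ^ 2 / 2)) * x i := by
  have h := (((hasStrictFDerivAt_norm_sq x).hasFDerivAt.const_mul a).mul_const (2⁻¹ : ℝ)).exp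
  simp only [← div_eq_mul_inv] at h
  rw [h.fderiv]
  simp [EuclideanSpace.inner_single_right]
  ring

lemma gaussian_eq (x : EuclideanSpace ℝ (Fin N)) :
    gaussian x = Real.exp (-1 * ‖x‖ ^ 2 / 2) := by
  rw [gaussian, neg_one_mul]

lemma gaussian_pos (x : EuclideanSpace ℝ (Fin N)) : 0 < gaussian x := Real.exp_pos _

lemma contDiff_gaussian : ContDiff ℝ ∞ (gaussian (N := N)) := by
  simpa only [← gaussian_eq] using contDiff_exp_norm_sq (N := N) (-1)

lemma fderiv_gaussian (x : EuclideanSpace ℝ (Fin N)) (i : Fin N) :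
    fderiv ℝ gaussian x (EuclideanSpace.single i 1) = -(x i * gaussian x) := by
  have h := fderiv_exp_norm_sq (-1) x i
  simp only [← gaussian_eq] at h
  rw [show gaussian = fun y : EuclideanSpace ℝ (Fin N) => gaussian y from rfl, h]
  ring

lemma coord_mul_mem_span_hermiteProd {f : EuclideanSpace ℝ (Fin N) → ℝ}
    (hf : f ∈ Submodule.span ℝ (Set.range (hermiteProd (N := N)))) (i : Fin N) :
    (fun x => x i * f x) ∈ Submodule.span ℝ (Set.range (hermiteProd (N := N))) := by
  simpa [EuclideanSpace.inner_single_right] using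
    inner_mul_mem_span_hermiteProd (EuclideanSpace.single i 1) hf

lemma gaussian_mem_span_hermiteProd :
    gaussian ∈ Submodule.span ℝ (Set.range (hermiteProd (N := N))) := by
  simpa using inner_pow_mul_gaussian_mem_span_hermiteProd (N := N) 0 0

lemma memLp_gaussian : MemLp (gaussian (N := N)) 2 :=
  memLp_of_mem_span_hermiteProd gaussian_mem_span_hermiteProd

lemma memLp_smul_id_of_mem_span_hermiteProd {f : EuclideanSpace ℝ (Fin N) → ℝ}
    (hf : f ∈ Submodule.span ℝ (Set.range (hermiteProd (N := N)))) :
    MemLp (fun x => f x • x) 2 := by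
  refine MemLp.of_eval_piLp fun i => ?_
  simpa only [PiLp.smul_apply, smul_eq_mul, mul_comm] using
    memLp_of_mem_span_hermiteProd (coord_mul_mem_span_hermiteProd hf i)

lemma hasWeakGradient_gaussian :
    HasWeakGradient (gaussian (N := N)) fun x => -(gaussian x • x) := by
  refine hasWeakGradient_of_contDiff contDiff_gaussian ?_ fun x i => ?_
  · exact (contDiff_gaussian.continuous.smul continuous_id).neg
  · rw [fderiv_gaussian]
    simp [mul_comm]

lemma norm_smul_id_sq (a : ℝ) (x : EuclideanSpace ℝ (Fin N)) :
    ‖a • x‖ ^ 2 = ‖x‖ ^ 2 * |a| ^ 2 := by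
  rw [norm_smul, mul_pow, Real.norm_eq_abs, mul_comm]

lemma HasWeakGradient.deficit_eq (hG : HasWeakGradient u G) (hu : MemLp u 2)
    (hxu : MemLp (fun x => u x • x) 2) (hG2 : MemLp G 2) :
    deficit u = ∫ x, ‖u x • x + G x‖ ^ 2 := by
  have h : ∫ x, ‖weakGradient u x‖ ^ 2 = ∫ x, ‖G x‖ ^ 2 := by
    refine integral_congr_ae ?_
    filter_upwards [hG.weakGradient_ae_eq] with x hx
    rw [hx]
  simp only [hG.integral_norm_add_sq hu hxu hG2, deficit, h, norm_smul_id_sq, sq_abs]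

/-- As subtracting Gaussians leaves the deficit unchanged, only the `L²` term depends on `c` in the
infimum. -/
lemma fullNormSq_eq_deficit_add (w : EuclideanSpace ℝ (Fin N) → ℝ) :
    fullNormSq w = deficit w + (N + 1) * ∫ x, w x ^ 2 := by
  simp only [fullNormSq, deficit, sq_abs]
  ring

lemma fullNormSq_nonneg (w : EuclideanSpace ℝ (Fin N) → ℝ) : 0 ≤ fullNormSq w := by
  unfold fullNormSq
  have h1 : 0 ≤ ∫ x, ‖weakGradient w x‖ ^ 2 := integral_nonneg fun x => by positivity
  have h2 : 0 ≤ ∫ x, ‖x‖ ^ 2 * |w x| ^ 2 := integral_nonneg fun x => by positivity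
  have h3 : 0 ≤ ∫ x, |w x| ^ 2 := integral_nonneg fun x => by positivity
  positivity

lemma gaussianDistSq_le (u : EuclideanSpace ℝ (Fin N) → ℝ) (c : ℝ) :
    gaussianDistSq u ≤ fullNormSq fun x => u x - c * gaussian x :=
  ciInf_le ⟨0, by rintro _ ⟨c, rfl⟩; exact fullNormSq_nonneg _⟩ c

section SubGaussian

lemma HasWeakGradient.sub_gaussian (hG : HasWeakGradient u G) (c : ℝ) :
    HasWeakGradient (fun x => u x - c * gaussian x) (fun x => G x - c • -(gaussian x • x)) :=
  hG.sub_const_mul hasWeakGradient_gaussian c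

lemma memLp_sub_gaussian (hu : MemLp u 2) (c : ℝ) :
    MemLp (fun x => u x - c * gaussian x) 2 :=
  hu.sub (memLp_gaussian.const_mul c)

lemma memLp_sub_gaussian_smul_id (hxu : MemLp (fun x => u x • x) 2) (c : ℝ) :
    MemLp (fun x => (u x - c * gaussian x) • x) 2 := by
  simp only [sub_smul, mul_smul]
  exact hxu.sub
    ((memLp_smul_id_of_mem_span_hermiteProd gaussian_mem_span_hermiteProd).const_smul c)

lemma memLp_grad_sub_gaussian (hG2 : MemLp G 2) (c : ℝ) :
    MemLp (fun x => G x - c • -(gaussian x • x)) 2 :=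
  hG2.sub
    ((memLp_smul_id_of_mem_span_hermiteProd gaussian_mem_span_hermiteProd).neg.const_smul c)

lemma sub_gaussian_mem_X (hu : u ∈ X N) (c : ℝ) :
    (fun x => u x - c * gaussian x) ∈ X N := by
  obtain ⟨⟨hu, G, hG2, hG⟩, hxu⟩ := hu
  exact ⟨⟨memLp_sub_gaussian hu c, _, memLp_grad_sub_gaussian hG2 c, hG.sub_gaussian c⟩,
    memLp_sub_gaussian_smul_id hxu c⟩

/-- The deficit is invariant under subtraction of the extremal Gaussians. -/
lemma deficit_sub_gaussian (hu : u ∈ X N) (c : ℝ) :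
    deficit (fun x => u x - c * gaussian x) = deficit u := by
  obtain ⟨⟨hu, G, hG2, hG⟩, hxu⟩ := hu
  rw [hG.deficit_eq hu hxu hG2, (hG.sub_gaussian c).deficit_eq (memLp_sub_gaussian hu c)
    (memLp_sub_gaussian_smul_id hxu c) (memLp_grad_sub_gaussian hG2 c)]
  -- The Gaussian `g` satisfies `∇g + x g = 0`, so the two integrands agree pointwise.
  congr 1
  funext x
  congr 2
  module

end SubGaussian

/-- The stability inequality. -/
lemma gaussianDistSq_le_mul_deficit (hu : u ∈ X N) :
    gaussianDistSq u ≤ ((N : ℝ) + 3) / 2 * deficit u := by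
  obtain ⟨⟨hu2, G, hG2, hG⟩, hxu⟩ := id hu
  let a : ℝ := ∫ x, u x * hermiteProd 0 x
  -- Chosen so that `c e^{-|x|²/2}` is the `L²` projection of `u` onto `hermiteProd 0`; the
  -- remainder has no mode at `0`.
  let c : ℝ := a * (√√Real.pi)⁻¹ ^ N
  have hc (x : EuclideanSpace ℝ (Fin N)) : c * gaussian x = a * hermiteProd 0 x := by
    rw [hermiteProd_zero, mul_assoc]
  have hP := (hG.sub_gaussian c).two_mul_le_integral_norm_add_sq (memLp_sub_gaussian hu2 c)
    (memLp_sub_gaussian_smul_id hxu c) (memLp_grad_sub_gaussian hG2 c)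
  rw [← (hG.sub_gaussian c).deficit_eq (memLp_sub_gaussian hu2 c)
    (memLp_sub_gaussian_smul_id hxu c) (memLp_grad_sub_gaussian hG2 c),
    deficit_sub_gaussian hu] at hP
  have h0 : ∫ x, (u x - c * gaussian x) * hermiteProd 0 x = 0 := by
    have i1 : Integrable fun x => u x * hermiteProd 0 x :=
      hu2.integrable_mul (memLp_hermiteProd 0)
    simp only [hc, sub_mul, mul_assoc a]
    rw [integral_sub i1 ((integrable_hermiteProd_mul 0 0).const_mul a), integral_const_mul,
      integral_hermiteProd_mul]
    simp [a]
  rw [h0] at hP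
  have h := gaussianDistSq_le u c
  rw [fullNormSq_eq_deficit_add, deficit_sub_gaussian hu] at h
  have hN : (0 : ℝ) ≤ (N : ℝ) + 1 := by positivity
  -- With `D` the deficit and `w` the remainder, `2 ∫ w² ≤ D` gives `D + (N + 1) ∫ w² ≤ (1 + (N + 1)
  -- / 2) D`.
  nlinarith [mul_le_mul_of_nonneg_left hP hN]

/-- The ground state transformation `u = F e^{-|x|²/2}`. -/
lemma HasWeakGradient.mul_exp_norm_sq (hG : HasWeakGradient u G) :
    HasWeakGradient (fun x => u x * Real.exp (‖x‖ ^ 2 / 2))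
      (fun x => Real.exp (‖x‖ ^ 2 / 2) • G x + u x • Real.exp (‖x‖ ^ 2 / 2) • x) := by
  have h1 := contDiff_exp_norm_sq (N := N) 1
  have h2 := fderiv_exp_norm_sq (N := N) 1
  simp only [one_mul] at h1 h2
  refine hG.mul_contDiff h1 (h1.continuous.smul continuous_id) fun x i => ?_
  rw [h2]
  simp

/-- The gradient of `u e^{|x|²/2}` is `e^{|x|²/2} (∇u + x u)`, and the weight cancels the squared
exponential. -/
lemma HasWeakGradient.norm_weakGradient_mul_exp_ae_eq (hG : HasWeakGradient u G) :
    (fun x => ‖weakGradient (fun y => u y * Real.exp (‖y‖ ^ 2 / 2)) x‖ ^ 2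
      * Real.exp (-‖x‖ ^ 2)) =ᵐ[volume] fun x => ‖u x • x + G x‖ ^ 2 := by
  filter_upwards [hG.mul_exp_norm_sq.weakGradient_ae_eq] with x hx
  have e : Real.exp (‖x‖ ^ 2 / 2) • G x + u x • Real.exp (‖x‖ ^ 2 / 2) • x
      = Real.exp (‖x‖ ^ 2 / 2) • (u x • x + G x) := by module
  rw [hx, e, norm_smul, mul_pow, Real.norm_of_nonneg (Real.exp_pos _).le, ← Real.exp_nat_mul,
    mul_right_comm, ← Real.exp_add]
  have h0 : ((2 : ℕ) : ℝ) * (‖x‖ ^ 2 / 2) + -‖x‖ ^ 2 = 0 := by push_cast; ring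
  rw [h0, Real.exp_zero, one_mul]

/-! ### The extremal function `x_i e^{-|x|²/2}`. -/

section Extremal

variable (i : Fin N)

lemma hasWeakGradient_coord_mul_gaussian :
    HasWeakGradient (fun x : EuclideanSpace ℝ (Fin N) => x i * gaussian x)
      (fun x => gaussian x • EuclideanSpace.single i 1 + x i • -(gaussian x • x)) := by
  have h1 : HasWeakGradient (fun x : EuclideanSpace ℝ (Fin N) => x i)
      (fun _ => EuclideanSpace.single i 1) := by
    refine hasWeakGradient_of_contDiff (by fun_prop) continuous_const fun x j => ?_
    have hf : HasFDerivAt (fun x : EuclideanSpace ℝ (Fin N) => x i)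
        (EuclideanSpace.proj i : EuclideanSpace ℝ (Fin N) →L[ℝ] ℝ) x :=
      (EuclideanSpace.proj i : EuclideanSpace ℝ (Fin N) →L[ℝ] ℝ).hasFDerivAt
    rw [hf.fderiv]
    simp [eq_comm]
  refine h1.mul_contDiff contDiff_gaussian ?_ fun x j => ?_
  · exact (contDiff_gaussian.continuous.smul continuous_id).neg
  · rw [fderiv_gaussian]
    simp [mul_comm]

lemma coord_mul_gaussian_mem_span :
    (fun x : EuclideanSpace ℝ (Fin N) => x i * gaussian x)
      ∈ Submodule.span ℝ (Set.range (hermiteProd (N := N))) :=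
  coord_mul_mem_span_hermiteProd gaussian_mem_span_hermiteProd i

lemma memLp_coord_mul_gaussian :
    MemLp (fun x : EuclideanSpace ℝ (Fin N) => x i * gaussian x) 2 :=
  memLp_of_mem_span_hermiteProd (coord_mul_gaussian_mem_span i)

lemma memLp_grad_coord_mul_gaussian :
    MemLp (fun x : EuclideanSpace ℝ (Fin N) =>
      gaussian x • EuclideanSpace.single i (1 : ℝ) + x i • -(gaussian x • x)) 2 := by
  refine MemLp.add ?_ ?_
  · refine MemLp.of_eval_piLp fun j => ?_
    simpa only [PiLp.smul_apply, smul_eq_mul] using memLp_gaussian.mul_const _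
  · simpa only [smul_neg, smul_smul] using!
      (memLp_smul_id_of_mem_span_hermiteProd (coord_mul_gaussian_mem_span i)).neg

lemma coord_mul_gaussian_mem_X :
    (fun x : EuclideanSpace ℝ (Fin N) => x i * gaussian x) ∈ X N :=
  ⟨⟨memLp_coord_mul_gaussian i, _, memLp_grad_coord_mul_gaussian i,
    hasWeakGradient_coord_mul_gaussian i⟩,
    memLp_smul_id_of_mem_span_hermiteProd (coord_mul_gaussian_mem_span i)⟩

/-- For `v = x_i g`, with `g` the Gaussian, `∇v + x v = g e_i`. -/
lemma deficit_coord_mul_gaussian :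
    deficit (fun x : EuclideanSpace ℝ (Fin N) => x i * gaussian x)
      = ∫ x : EuclideanSpace ℝ (Fin N), gaussian x ^ 2 := by
  rw [(hasWeakGradient_coord_mul_gaussian i).deficit_eq (memLp_coord_mul_gaussian i)
    (memLp_smul_id_of_mem_span_hermiteProd (coord_mul_gaussian_mem_span i))
    (memLp_grad_coord_mul_gaussian i)]
  congr 1
  funext x
  have e : (x i * gaussian x) • x
      + (gaussian x • EuclideanSpace.single i (1 : ℝ) + x i • -(gaussian x • x))
      = gaussian x • EuclideanSpace.single i (1 : ℝ) := by module
  rw [e, norm_smul, PiLp.norm_single]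
  simp

lemma integral_gaussian_sq_pos : 0 < ∫ x : EuclideanSpace ℝ (Fin N), gaussian x ^ 2 :=
  integral_pos_of_integrable_nonneg_nonzero (x := 0) (contDiff_gaussian.continuous.pow 2)
    memLp_gaussian.integrable_sq (fun _ => sq_nonneg _) (pow_ne_zero 2 (gaussian_pos 0).ne')

lemma memLp_fderiv_gaussian :
    MemLp (fun x => fderiv ℝ (gaussian (N := N)) x (EuclideanSpace.single i 1)) 2 := by
  simp only [fderiv_gaussian]
  exact (memLp_coord_mul_gaussian i).neg

/-- Testing the weak gradient of the Gaussian against the Gaussian shows that the integral equals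
its own negative. -/
lemma integral_coord_mul_gaussian_mul_gaussian :
    ∫ x : EuclideanSpace ℝ (Fin N), x i * gaussian x * gaussian x = 0 := by
  have h := hasWeakGradient_gaussian.integral_mul_fderiv memLp_gaussian
    (memLp_smul_id_of_mem_span_hermiteProd gaussian_mem_span_hermiteProd).neg
    contDiff_gaussian memLp_gaussian i (memLp_fderiv_gaussian i)
  simp only [fderiv_gaussian, PiLp.neg_apply, PiLp.smul_apply, smul_eq_mul, neg_mul,
    integral_neg, neg_neg, mul_comm (gaussian _)] at h
  linarith

/-- Test `∂_i (x_i g) = g - x_i² g` against the Gaussian `g`. -/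
lemma integral_coord_mul_gaussian_sq :
    2 * ∫ x : EuclideanSpace ℝ (Fin N), (x i * gaussian x) ^ 2
      = ∫ x : EuclideanSpace ℝ (Fin N), gaussian x ^ 2 := by
  have h := (hasWeakGradient_coord_mul_gaussian i).integral_mul_fderiv
    (memLp_coord_mul_gaussian i) (memLp_grad_coord_mul_gaussian i) contDiff_gaussian
    memLp_gaussian i (memLp_fderiv_gaussian i)
  have e (x : EuclideanSpace ℝ (Fin N)) : gaussian x *
      (gaussian x • EuclideanSpace.single i (1 : ℝ) + x i • -(gaussian x • x)) i
      = gaussian x ^ 2 - (x i * gaussian x) ^ 2 := by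
    simp
    ring
  simp only [fderiv_gaussian, mul_neg, integral_neg, neg_inj, e, ← sq] at h
  rw [integral_sub memLp_gaussian.integrable_sq
    (memLp_coord_mul_gaussian i).integrable_sq] at h
  linarith

lemma gaussianDistSq_coord_mul_gaussian :
    gaussianDistSq (fun x : EuclideanSpace ℝ (Fin N) => x i * gaussian x)
      = ((N : ℝ) + 3) / 2 * ∫ x : EuclideanSpace ℝ (Fin N), gaussian x ^ 2 := by
  -- The cross term vanishes and `∫ (x_i g)² = ½ ∫ g²`, so the full norm is `1 + (N + 1) (½ + c²)`
  -- times `∫ g²`, minimal at `c = 0`.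
  have hfull (c : ℝ) : fullNormSq
      (fun x : EuclideanSpace ℝ (Fin N) => x i * gaussian x - c * gaussian x)
      = ((N : ℝ) + 3) / 2 * (∫ x : EuclideanSpace ℝ (Fin N), gaussian x ^ 2)
        + (N + 1) * (c ^ 2 * ∫ x : EuclideanSpace ℝ (Fin N), gaussian x ^ 2) := by
    have e (x : EuclideanSpace ℝ (Fin N)) : (x i * gaussian x - c * gaussian x) ^ 2
        = (x i * gaussian x) ^ 2 + c ^ 2 * gaussian x ^ 2
          - 2 * c * (x i * gaussian x * gaussian x) := by ring
    have i1 : Integrable fun x : EuclideanSpace ℝ (Fin N) => (x i * gaussian x) ^ 2 :=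
      (memLp_coord_mul_gaussian i).integrable_sq
    have i2 : Integrable fun x : EuclideanSpace ℝ (Fin N) => c ^ 2 * gaussian x ^ 2 :=
      memLp_gaussian.integrable_sq.const_mul _
    have i3 : Integrable fun x : EuclideanSpace ℝ (Fin N) =>
        2 * c * (x i * gaussian x * gaussian x) :=
      ((memLp_coord_mul_gaussian i).integrable_mul memLp_gaussian).const_mul _
    have i12 : Integrable fun x : EuclideanSpace ℝ (Fin N) =>
        (x i * gaussian x) ^ 2 + c ^ 2 * gaussian x ^ 2 := i1.add i2
    rw [fullNormSq_eq_deficit_add, deficit_sub_gaussian (coord_mul_gaussian_mem_X i),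
      deficit_coord_mul_gaussian]
    simp only [e]
    rw [integral_sub i12 i3, integral_add i1 i2, integral_const_mul, integral_const_mul,
      integral_coord_mul_gaussian_mul_gaussian, ← integral_coord_mul_gaussian_sq i]
    ring
  refine le_antisymm ?_ (le_ciInf fun c => ?_)
  · refine (gaussianDistSq_le _ 0).trans_eq ?_
    rw [hfull]
    ring
  · rw [hfull, le_add_iff_nonneg_right]
    have := integral_gaussian_sq_pos (N := N)
    positivity

end Extremal

end Heisenberg

/-! ### The theorem. -/

theorem theorem1p4 (N : ℕ) (hN : 0 < N) :
    -- The identity and the inequality, with all the integrals involved finite.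
    (∀ u ∈ Heisenberg.X N,
      Heisenberg.WeaklyDifferentiable (fun x => u x * Real.exp (‖x‖ ^ 2 / 2)) ∧
      Integrable (fun x =>
        ‖Heisenberg.weakGradient (fun y => u y * Real.exp (‖y‖ ^ 2 / 2)) x‖ ^ 2
          * Real.exp (-‖x‖ ^ 2)) ∧
      Heisenberg.deficit u =
        ∫ x, ‖Heisenberg.weakGradient (fun y => u y * Real.exp (‖y‖ ^ 2 / 2)) x‖ ^ 2
          * Real.exp (-‖x‖ ^ 2) ∧
      (∀ c : ℝ, (fun x => u x - c * Heisenberg.gaussian x) ∈ Heisenberg.X N) ∧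
      Heisenberg.deficit u ≥ 2 / ((N : ℝ) + 3) * Heisenberg.gaussianDistSq u) ∧
    -- The function `x₁ e^{-|x|²/2}` is a nontrivial case of equality.
    ((fun x : EuclideanSpace ℝ (Fin N) => x ⟨0, hN⟩ * Heisenberg.gaussian x) ∈ Heisenberg.X N ∧
      0 < Heisenberg.deficit
        (fun x : EuclideanSpace ℝ (Fin N) => x ⟨0, hN⟩ * Heisenberg.gaussian x) ∧
      Heisenberg.deficit
          (fun x : EuclideanSpace ℝ (Fin N) => x ⟨0, hN⟩ * Heisenberg.gaussian x) =
        2 / ((N : ℝ) + 3) * Heisenberg.gaussianDistSq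
          (fun x : EuclideanSpace ℝ (Fin N) => x ⟨0, hN⟩ * Heisenberg.gaussian x)) ∧
    -- The constant `2 / (N + 3)` is the largest possible.
    IsGreatest {K : ℝ | ∀ u ∈ Heisenberg.X N,
      Heisenberg.deficit u ≥ K * Heisenberg.gaussianDistSq u} (2 / ((N : ℝ) + 3)) := by
  have hN3 : (0 : ℝ) < (N : ℝ) + 3 := by positivity
  have hineq : ∀ u ∈ Heisenberg.X N,
      Heisenberg.deficit u ≥ 2 / ((N : ℝ) + 3) * Heisenberg.gaussianDistSq u := by
    intro u hu
    have h := Heisenberg.gaussianDistSq_le_mul_deficit hu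
    rw [ge_iff_le, div_mul_eq_mul_div, div_le_iff₀ hN3]
    linarith
  have hpos := Heisenberg.integral_gaussian_sq_pos (N := N)
  refine ⟨fun u hu => ?_, ⟨Heisenberg.coord_mul_gaussian_mem_X _, ?_, ?_⟩, hineq, ?_⟩
  · obtain ⟨⟨hu2, G, hG2, hG⟩, hxu⟩ := id hu
    refine ⟨⟨_, hG.mul_exp_norm_sq⟩, ?_, ?_, Heisenberg.sub_gaussian_mem_X hu, hineq u hu⟩
    · exact ((hxu.add hG2).integrable_norm_pow two_ne_zero).congr
        hG.norm_weakGradient_mul_exp_ae_eq.symm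
    · rw [hG.deficit_eq hu2 hxu hG2]
      exact integral_congr_ae hG.norm_weakGradient_mul_exp_ae_eq.symm
  · rwa [Heisenberg.deficit_coord_mul_gaussian]
  · rw [Heisenberg.deficit_coord_mul_gaussian, Heisenberg.gaussianDistSq_coord_mul_gaussian]
    field_simp
  · intro K hK
    -- On the extremal function an admissible `K` satisfies `K (N + 3) / 2 ≤ 1`, after division by
    -- the positive `∫ g²`.
    have h := hK _ (Heisenberg.coord_mul_gaussian_mem_X ⟨0, hN⟩)
    rw [Heisenberg.deficit_coord_mul_gaussian, Heisenberg.gaussianDistSq_coord_mul_gaussian,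
      ge_iff_le, ← mul_assoc, mul_le_iff_le_one_left hpos] at h
    rw [le_div_iff₀ hN3]
    linarith
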